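/- Conventions. A graph is a tuple $G=(V_G,E^{\rm dir}_G,h_G,t_G,\iota_G)$ with finite sets $V_G$ of vertices and $E^{\rm dir}_G$ of directed edges, head and tail maps $h_G,t_G\colon E^{\rm dir}_G\to V_G$, and an involution $\iota_G$ of $E^{\rm dir}_G$ with $t_G\iota_G=h_G$. Its edges are the orbits $\{e,\iota_Ge\}$; a half-loop is a fixed point of $\iota_G$, a whole-loop is an edge $\{e,\iota_Ge\}$ with $e\neq\iota_Ge$ and $h_Ge=t_Ge$. The degree of a vertex is the number of directed edges with that tail, the order is ${\rm ord}(G)=\#E_G-\#V_G$, and $\mu_1(G)$ is the Perron–Frobenius eigenvalue (spectral radius) of the non-backtracking (Hashimoto) matrix of $G$, whose $(e,f)$ entry is $1$ if $h_Ge=t_Gf$ and $\iota_Ge\ne f$, and $0$ otherwise. Let $B$ be a graph. A coordinatized cover of $B$ of degree $n$ is a graph $G$ with $V_G=V_B\times[n]$, $E^{\rm dir}_G=E^{\rm dir}_B\times[n]$, $t_G(e,i)=(t_Be,i)$, $h_G(e,i)=(h_Be,\sigma(e)i)$, $\iota_G(e,i)=(\iota_Be,\sigma(e)i)$, where $\sigma$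 assigns to each directed edge a permutation of $[n]$ with $\sigma(\iota_Be)=\sigma(e)^{-1}$. A model $\{\mathcal C_n(B)\}_{n\in N}$ over $B$ consists of an infinite set $N$ of positive integers and, for each $n\in N$, a finite probability space whose atoms (all of positive probability) are coordinatized covers of $B$ of degree $n$. If $B$ has no half-loops, the permutation model is the one with $N=\{1,2,\dots\}$ and the uniform distribution on all coordinatized covers of degree $n$. A finite graph $S$ occurs in the model if for some morphism $S\to B$ it holds, for all sufficiently large $n\in N$, that $S$ is isomorphic, over $B$, to a subgraph of some atom of $\mathcal C_n(B)$. The tangle power $\tau_{\rm tang}$ of the model is the smallest order of a connected graph $S$ that occurs in the model and satisfies $\mu_1(S)>\mu_1(B)^{1/2}$ ($+\infty$ if there is none). Theorem. Let $B$ be a graph and let $m$ be the smallest integer with $2m-1>\mu_1(B)^{1/2}$. Then for any model over $B$ (in particular, for any algebraic model) $\tau_{\rm tang}\ge m-1$, and equality holds if the bouquet of $m$ whole-loops (the graph with one vertex and $m$ whole-loops as its only edges) occurs in the model. If $B$ has at least one vertex and is $d$-regular, $d\ge1$, then $\mu_1(B)=d-1$, $$m=\Bigl\lfloor\bigl((d-1)^{1/2}+1\bigr)/2\Bigr\rfloor+1,$$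 and for any model over $B$ $$\tau_{\rm tang}\ge\Bigl\lfloor\bigl((d-1)^{1/2}+1\bigr)/2\Bigr\rfloor ;$$ furthermore, if $B$ has no half-loops and has a vertex incident upon at least $m$ whole-loops, then equality holds in this last bound for the permutation model over $B$. -/

import Mathlib

universe u v w x

/-- A graph with vertex set `V` and set of directed edges `E`; multiple edges and self-loops are
allowed. The involution `inv` reverses directed edges, and may have fixed points (half-loops). -/
structure MGraph (V : Type u) (E : Type v) where
  tail : E → V
  head : E → V
  inv : E → E
  inv_inv : ∀ e, inv (inv e) = e
  tail_inv : ∀ e, tail (inv e) = head e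

namespace MGraph

variable {V : Type u} {E : Type v} {W : Type w} {F : Type x}

/-- The (undirected) edges: the orbits `{e, inv e}` of the involution. -/
def edgeSet (G : MGraph V E) : Set (Set E) := {s | ∃ e, s = {e, G.inv e}}

/-- The order of a finite graph: number of edges minus number of vertices. -/
noncomputable def order (G : MGraph V E) : ℤ := (G.edgeSet.ncard : ℤ) - (Nat.card V : ℤ)

/-- The degree of a vertex: the number of directed edges with that tail. A whole-loop
contributes two, a half-loop contributes one. -/
noncomputable def degree (G : MGraph V E) (a : V) : ℕ := {e : E | G.tail e = a}.ncard

def IsRegular (G : MGraph V E) (d : ℕ) : Prop := ∀ a, G.degree a = d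

/-- No directed edge is its own reverse. -/
def NoHalfLoops (G : MGraph V E) : Prop := ∀ e, G.inv e ≠ e

/-- The whole-loops at a vertex: edges `{e, inv e}` with `inv e ≠ e` and both ends at the vertex. -/
def wholeLoopsAt (G : MGraph V E) (a : V) : Set (Set E) :=
  {s | ∃ e, G.tail e = a ∧ G.head e = a ∧ G.inv e ≠ e ∧ s = {e, G.inv e}}

/-- There is a vertex, and any two vertices are joined by a walk. -/
def Connected (G : MGraph V E) : Prop :=
  Nonempty V ∧ ∀ a b, Relation.ReflTransGen (fun c c' => ∃ e, G.tail e = c ∧ G.head e = c') a b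

open Classical in
/-- The Hashimoto (non-backtracking) matrix. -/
noncomputable def hashimoto (G : MGraph V E) : Matrix E E ℂ :=
  Matrix.of fun e f => if G.head e = G.tail f ∧ G.inv e ≠ f then 1 else 0

/-- The Perron-Frobenius eigenvalue of the Hashimoto matrix. For a matrix with non-negative
entries this is its spectral radius; it is `0` if there are no edges. -/
noncomputable def mu1 [Fintype E] [DecidableEq E] (G : MGraph V E) : ℝ :=
  (spectralRadius ℂ G.hashimoto).toReal

/-- Morphisms of graphs. -/
structure Hom (G : MGraph V E) (H : MGraph W F) where
  onV : V → W
  onE : E → F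
  tail_comm : ∀ e, H.tail (onE e) = onV (G.tail e)
  head_comm : ∀ e, H.head (onE e) = onV (G.head e)
  inv_comm : ∀ e, H.inv (onE e) = onE (G.inv e)

/-- The graph with one vertex and `m` whole-loops. -/
def bouquet (m : ℕ) : MGraph Unit (Fin m × Bool) where
  tail _ := ()
  head _ := ()
  inv e := (e.1, !e.2)
  inv_inv e := by simp
  tail_inv _ := rfl

/-- A coordinatized cover of `B` of degree `n`, given by its permutation assignment. -/
structure Coord (B : MGraph V E) (n : ℕ) where
  σ : E → Equiv.Perm (Fin n)
  σ_inv : ∀ e, σ (B.inv e) = (σ e)⁻¹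

variable {B : MGraph V E}

/-- The underlying graph of a coordinatized cover. -/
def Coord.graph {n : ℕ} (G : Coord B n) : MGraph (V × Fin n) (E × Fin n) where
  tail p := (B.tail p.1, p.2)
  head p := (B.head p.1, G.σ p.1 p.2)
  inv p := (B.inv p.1, G.σ p.1 p.2)
  inv_inv p := by simp [B.inv_inv, G.σ_inv]
  tail_inv p := by simp [B.tail_inv]

instance Coord.instNonempty (n : ℕ) : Nonempty (Coord B n) := ⟨⟨fun _ => 1, fun _ => by simp⟩⟩

instance Coord.instFinite [Finite E] (n : ℕ) : Finite (Coord B n) :=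
  Finite.of_injective (fun G : Coord B n => G.σ) (by rintro ⟨s, _⟩ ⟨t, _⟩ h; cases h; rfl)

/-- A model over `B`: for each `n` in an infinite set `N` of positive integers, a probability
space whose atoms are coordinatized covers of `B` of degree `n`. The atoms are the elements of
the support of `prob n`. -/
structure Model (B : MGraph V E) where
  N : Set ℕ
  infinite : N.Infinite
  pos : ∀ n ∈ N, 0 < n
  prob : ∀ n : N, PMF (Coord B n)

open Classical in
/-- The permutation model over a graph without half-loops: for every `n ≥ 1`, the uniform
distribution on all coordinatized covers of degree `n`. -/
noncomputable def permutationModel [Finite E] (B : MGraph V E) (_hB : B.NoHalfLoops) :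
    Model B where
  N := {n | 0 < n}
  infinite := Set.infinite_of_not_bddAbove fun ⟨b, hb⟩ => by
    have := hb (show b + 1 ∈ {n : ℕ | 0 < n} from Nat.succ_pos b)
    omega
  pos _ hn := hn
  prob n :=
    letI : Fintype (Coord B n) := Fintype.ofFinite _
    PMF.uniformOfFintype (Coord B n)

/-- The graph `S` with `B`-graph structure `p` occurs in the model: for all sufficiently large `n`
in `N` it is isomorphic to a `B`-subgraph of some atom, that is, there is an injective morphism
of `B`-graphs from `S` to that atom. -/
def Model.OccursOver (M : Model B) {S : MGraph W F} (p : Hom S B) : Prop :=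
  ∃ n₀ : ℕ, ∀ n : M.N, n₀ ≤ (n : ℕ) → ∃ G ∈ (M.prob n).support, ∃ f : Hom S G.graph,
    Function.Injective f.onV ∧ Function.Injective f.onE ∧
    (∀ a, (f.onV a).1 = p.onV a) ∧ (∀ e, (f.onE e).1 = p.onE e)

/-- `S` occurs in the model if it does so with some `B`-graph structure. -/
def Model.Occurs (M : Model B) (S : MGraph W F) : Prop := ∃ p : Hom S B, M.OccursOver p

/-- The orders of the connected finite graphs `S` that occur in the model and satisfy
`μ₁(S) > μ₁(B)^(1/2)`. (Every finite graph is isomorphic to one whose vertices and directed edges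
form types in the lowest universe.) -/
def Model.tangleOrders [Fintype E] [DecidableEq E] (M : Model B) : Set ℤ :=
  {k | ∃ (W F : Type) (_ : Fintype W) (_ : Fintype F) (_ : DecidableEq F) (S : MGraph W F),
    S.Connected ∧ M.Occurs S ∧ Real.sqrt B.mu1 < S.mu1 ∧ S.order = k}

/-- The tangle power: the smallest element of `tangleOrders`, or `⊤` if there is none. -/
noncomputable def Model.tanglePower [Fintype E] [DecidableEq E] (M : Model B) : EReal :=
  ⨅ k ∈ M.tangleOrders, ((k : ℝ) : EReal)

/-- The tangle power is the integer `k` exactly if `k` is the least of the orders. -/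
theorem Model.tanglePower_eq_iff [Fintype E] [DecidableEq E] (M : Model B) (k : ℤ) :
    M.tanglePower = ((k : ℝ) : EReal) ↔ IsLeast M.tangleOrders k := by
  have lb : ∀ {j : ℤ}, ((j : ℝ) : EReal) ≤ M.tanglePower ↔ j ∈ lowerBounds M.tangleOrders := by
    intro j
    simp [Model.tanglePower, le_iInf_iff, lowerBounds]
  constructor
  · intro h
    have hk : k ∈ lowerBounds M.tangleOrders := lb.1 h.ge
    refine ⟨?_, hk⟩
    by_contra hn
    have h1 : k + 1 ∈ lowerBounds M.tangleOrders := by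
      intro j hj
      have h2 := hk hj
      have h3 : j ≠ k := by rintro rfl; exact hn hj
      omega
    have h4 := lb.2 h1
    rw [h] at h4
    norm_cast at h4
    omega
  · rintro ⟨h1, h2⟩
    exact le_antisymm (iInf₂_le k h1) (lb.2 h2)

end MGraph

/-! Everything rests on the inequality `μ₁(S) ≤ 2 ord(S) + 1` for connected `S` with `μ₁(S) > 0`
(`mu1_le_of_connected`), attained by bouquets of at least one whole-loop. If also `√μ₁(B) < μ₁(S)`,
then `k = ord(S) + 1` satisfies `√μ₁(B) < 2k - 1`, so `ord(S) ≥ m - 1` by minimality of `m`; the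
model plays no role in this bound.

For the inequality, the absolute values of an eigenvector form a nonnegative `y ≠ 0` with `R y ≤ H
y` entrywise, `H` being the Hashimoto matrix and `R` the modulus of the eigenvalue. When `R ≥ 1`,
this survives contraction of an edge with distinct ends (`sum_successors_le_contract`), which also
preserves the number of directed edges minus twice the number of vertices. Contracting down to one
vertex leaves a maximum argument (`le_of_subharmonic`). -/

namespace MGraph

open Finset

/-! ### Edge contraction and subharmonic functions -/

section Contraction

variable {V : Type u} {E : Type v}

theorem head_inv (G : MGraph V E) (e : E) : G.head (G.inv e) = G.tail e := by
  rw [← G.tail_inv, G.inv_inv]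

theorem inv_injective (G : MGraph V E) : Function.Injective G.inv :=
  Function.LeftInverse.injective G.inv_inv

open Classical in
/-- The directed edges which may follow `e` in a non-backtracking walk. -/
noncomputable def successors [Fintype E] (G : MGraph V E) (e : E) : Finset E :=
  {f | G.tail f = G.head e ∧ f ≠ G.inv e}

theorem mem_successors [Fintype E] {G : MGraph V E} {e f : E} :
    f ∈ G.successors e ↔ G.tail f = G.head e ∧ f ≠ G.inv e := by
  simp [successors]

open Classical in
/-- The map that identifies the endpoints of `e₀`, removing its head. -/
noncomputable def contractVertex (G : MGraph V E) (e₀ : E) (h : G.tail e₀ ≠ G.head e₀) (a : V) :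
    {a : V // a ≠ G.head e₀} :=
  if ha : a = G.head e₀ then ⟨G.tail e₀, h⟩ else ⟨a, ha⟩

theorem contractVertex_eq_iff (G : MGraph V E) (e₀ : E) (h : G.tail e₀ ≠ G.head e₀) (a b : V) :
    G.contractVertex e₀ h a = G.contractVertex e₀ h b ↔
      a = b ∨ (a = G.tail e₀ ∧ b = G.head e₀) ∨ (a = G.head e₀ ∧ b = G.tail e₀) := by
  unfold contractVertex
  split_ifs with ha hb hb
  · simp [ha, hb]
  · subst ha
    simp only [Subtype.mk.injEq]
    grind
  · subst hb
    simp only [Subtype.mk.injEq]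
    grind
  · simp only [Subtype.mk.injEq]
    grind

/-- The contraction of an edge with two distinct endpoints. -/
noncomputable def contract (G : MGraph V E) (e₀ : E) (h : G.tail e₀ ≠ G.head e₀) :
    MGraph {a : V // a ≠ G.head e₀} {e : E // e ≠ e₀ ∧ e ≠ G.inv e₀} where
  tail e := G.contractVertex e₀ h (G.tail e)
  head e := G.contractVertex e₀ h (G.head e)
  inv e := ⟨G.inv e, fun he => e.2.2 ((G.inv_inv _).symm.trans (congrArg G.inv he)),
    fun he => e.2.1 (G.inv_injective he)⟩
  inv_inv e := Subtype.ext (G.inv_inv e)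
  tail_inv e := by simp [G.tail_inv]

theorem Connected.contract {G : MGraph V E} (hG : G.Connected) (e₀ : E)
    (h : G.tail e₀ ≠ G.head e₀) : (G.contract e₀ h).Connected := by
  refine ⟨⟨⟨G.tail e₀, h⟩⟩, ?_⟩
  have key : ∀ a b, Relation.ReflTransGen (fun c c' => ∃ e, G.tail e = c ∧ G.head e = c') a b →
      Relation.ReflTransGen
        (fun c c' => ∃ e, (G.contract e₀ h).tail e = c ∧ (G.contract e₀ h).head e = c')
        (G.contractVertex e₀ h a) (G.contractVertex e₀ h b) := by
    intro a b hab
    induction hab with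
    | refl => exact .refl
    | tail _ hs ih =>
      obtain ⟨e, rfl, rfl⟩ := hs
      by_cases he : e ≠ e₀ ∧ e ≠ G.inv e₀
      · exact ih.tail ⟨⟨e, he⟩, rfl, rfl⟩
      · have : G.contractVertex e₀ h (G.tail e) = G.contractVertex e₀ h (G.head e) := by
          rw [contractVertex_eq_iff]
          by_cases h1 : e = e₀
          · simp [h1]
          · have h2 : e = G.inv e₀ := by tauto
            simp [h2, G.tail_inv, G.head_inv]
        rwa [← this]
  have hc : ∀ a : {a : V // a ≠ G.head e₀}, G.contractVertex e₀ h a = a := fun a => by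
    simp [contractVertex, a.2]
  intro a b
  have := key a b (hG.2 a b)
  rwa [hc, hc] at this

theorem exists_tail_ne_head [Fintype V] {G : MGraph V E} (hG : G.Connected)
    (h : 1 < Fintype.card V) : ∃ e, G.tail e ≠ G.head e := by
  obtain ⟨a, b, hab⟩ := Fintype.one_lt_card_iff.1 h
  by_contra! hn
  apply hab
  have := hG.2 a b
  induction this with
  | refl => rfl
  | tail _ hs ih =>
    obtain ⟨e, rfl, rfl⟩ := hs
    by_cases hx : a = G.tail e
    · rw [hx, hn]
    · exact absurd (ih hx) hx

/-- Bypassing the edge `e₁` in a sum over the successors of an edge that ends at its tail. -/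
theorem sum_successors_le [Fintype E] (G : MGraph V E) {R : ℝ} (hR : 1 ≤ R) (y : E → ℝ)
    (hy : ∀ e, 0 ≤ y e) (hsub : ∀ e, R * y e ≤ ∑ f ∈ G.successors e, y f)
    (e₁ e : E) (h : G.tail e₁ ≠ G.head e₁) (he : G.head e = G.tail e₁) (T : Finset E)
    (hT : ∀ f, f ≠ e₁ → f ≠ G.inv e₁ → f ≠ G.inv e →
      (G.tail f = G.tail e₁ ∨ G.tail f = G.head e₁) → f ∈ T) :
    ∑ f ∈ G.successors e, y f ≤ ∑ f ∈ T, y f := by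
  classical
  have h1 : ∑ f ∈ G.successors e, y f ≤ y e₁ + ∑ f ∈ (G.successors e).erase e₁, y f := by
    by_cases hm : e₁ ∈ G.successors e
    · rw [Finset.add_sum_erase _ _ hm]
    · rw [Finset.erase_eq_of_notMem hm]
      linarith [hy e₁]
  -- The only use of `R ≥ 1`: the value at `e₁` is replaced by the values at the edges that follow
  -- it.
  have h2 : y e₁ ≤ ∑ f ∈ G.successors e₁, y f := by nlinarith [hy e₁, hsub e₁]
  -- The two sets of edges leave different ends of `e₁`.
  have hd : Disjoint (G.successors e₁) ((G.successors e).erase e₁) := by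
    rw [Finset.disjoint_left]
    intro f hf hf'
    rw [Finset.mem_erase, mem_successors] at hf'
    rw [mem_successors] at hf
    exact h (by rw [← he, ← hf'.2.1, hf.1])
  have h3 : G.successors e₁ ∪ (G.successors e).erase e₁ ⊆ T := by
    intro f hf
    rw [Finset.mem_union, Finset.mem_erase, mem_successors, mem_successors] at hf
    rcases hf with ⟨ht, hi⟩ | ⟨h0, ht, hi⟩
    · refine hT f ?_ hi ?_ (Or.inr ht)
      · rintro rfl
        exact h ht
      · rintro rfl
        exact h (by rw [← he, ← G.tail_inv, ht])
    · refine hT f h0 ?_ hi (Or.inl (ht.trans he))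
      rintro rfl
      exact h (by rw [← he, ← ht, G.tail_inv])
  calc _ ≤ ∑ f ∈ G.successors e₁, y f + ∑ f ∈ (G.successors e).erase e₁, y f := by linarith
    _ = ∑ f ∈ G.successors e₁ ∪ (G.successors e).erase e₁, y f := (Finset.sum_union hd).symm
    _ ≤ _ := Finset.sum_le_sum_of_subset_of_nonneg h3 fun f _ _ => hy f

/-- A walk that crossed `e₀` now skips it. The successors of an edge ending at either end of `e₀`
come to include those reached across `e₀`, and these make up for the lost term `y e₀` or `y (inv
e₀)`. -/
theorem sum_successors_le_contract [Fintype E] (G : MGraph V E) {R : ℝ} (hR : 1 ≤ R) (y : E → ℝ)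
    (hy : ∀ e, 0 ≤ y e) (hsub : ∀ e, R * y e ≤ ∑ f ∈ G.successors e, y f)
    (e₀ : E) (h : G.tail e₀ ≠ G.head e₀) [Fintype {e : E // e ≠ e₀ ∧ e ≠ G.inv e₀}]
    (e : {e : E // e ≠ e₀ ∧ e ≠ G.inv e₀}) :
    R * y e ≤ ∑ f ∈ (G.contract e₀ h).successors e, y f := by
  classical
  set T := ((G.contract e₀ h).successors e).map (Function.Embedding.subtype _) with hTdef
  have hT : ∀ f, f ≠ e₀ → f ≠ G.inv e₀ → f ≠ G.inv e →
      G.contractVertex e₀ h (G.tail f) = G.contractVertex e₀ h (G.head e) → f ∈ T := by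
    intro f h1 h2 h3 h4
    rw [hTdef, Finset.mem_map]
    refine ⟨⟨f, h1, h2⟩, ?_, rfl⟩
    rw [mem_successors]
    exact ⟨h4, fun h5 => h3 (congrArg Subtype.val h5)⟩
  have hsum : ∑ f ∈ (G.contract e₀ h).successors e, y f = ∑ f ∈ T, y f := by
    rw [hTdef, Finset.sum_map]
    rfl
  rw [hsum]
  refine (hsub e).trans ?_
  by_cases hu : G.head e = G.tail e₀
  · refine G.sum_successors_le hR y hy hsub e₀ e h hu T fun f h1 h2 h3 h4 => hT f h1 h2 h3 ?_
    rw [contractVertex_eq_iff, hu]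
    tauto
  -- The mirror case: the bypassed edge is `inv e₀`.
  by_cases hv : G.head e = G.head e₀
  · refine G.sum_successors_le hR y hy hsub (G.inv e₀) e ?_ ?_ T fun f h1 h2 h3 h4 => ?_
    · rw [G.tail_inv, G.head_inv]
      exact h.symm
    · rw [hv, G.tail_inv]
    · rw [G.inv_inv] at h2
      rw [G.tail_inv, G.head_inv] at h4
      refine hT f h2 h1 h3 ?_
      rw [contractVertex_eq_iff]
      rcases h4 with h4 | h4
      · exact Or.inl (h4.trans hv.symm)
      · exact Or.inr (Or.inl ⟨h4, hv⟩)
  · refine Finset.sum_le_sum_of_subset_of_nonneg (fun f hf => ?_) fun f _ _ => hy f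
    rw [mem_successors] at hf
    refine hT f ?_ ?_ hf.2 (by rw [hf.1])
    · rintro rfl
      exact hu hf.1.symm
    · rintro rfl
      exact hv (by rw [← hf.1, G.tail_inv])

theorem card_contract_edges [Fintype E] (G : MGraph V E) (e₀ : E) (h : G.tail e₀ ≠ G.head e₀)
    [Fintype {e : E // e ≠ e₀ ∧ e ≠ G.inv e₀}] :
    Fintype.card {e : E // e ≠ e₀ ∧ e ≠ G.inv e₀} + 2 = Fintype.card E := by
  classical
  have hne : e₀ ≠ G.inv e₀ := fun h' => h (by rw [← G.tail_inv, ← h'])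
  rw [Fintype.card_subtype]
  have : (Finset.univ.filter fun e => e ≠ e₀ ∧ e ≠ G.inv e₀) = ({e₀, G.inv e₀} : Finset E)ᶜ := by
    ext e
    simp
  rw [this, ← Finset.card_pair hne, Finset.card_compl_add_card]

/-- A nonzero nonnegative function on the directed edges of a connected graph which is
subharmonic with factor `R ≥ 1` for the Hashimoto matrix bounds `R`. -/
theorem le_of_subharmonic (n : ℕ) : ∀ {V : Type u} {E : Type v} [Fintype V] [Fintype E]
    (G : MGraph V E) (_ : G.Connected) (_ : Fintype.card V = n + 1) {R : ℝ} (_ : 1 ≤ R)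
    (y : E → ℝ) (_ : ∀ e, 0 ≤ y e) (_ : ∀ e, R * y e ≤ ∑ f ∈ G.successors e, y f) (_ : y ≠ 0),
    R ≤ (Fintype.card E : ℝ) - 2 * Fintype.card V + 1 := by
  classical
  induction n with
  | zero =>
    intro V E _ _ G _ hV R hR y hy hsub hy0
    -- With one vertex, compare both sides at a maximum of `y`: only the reverse edge is excluded as
    -- a successor.
    obtain ⟨e, he⟩ := Function.ne_iff.1 hy0
    have : Nonempty E := ⟨e⟩
    obtain ⟨x, hx⟩ := Finite.exists_max y
    have hpos : 0 < y x := ((hy e).lt_of_ne' he).trans_le (hx e)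
    have h1 : ∑ f ∈ G.successors x, y f ≤ ((Fintype.card E : ℝ) - 1) * y x := by
      calc _ ≤ ∑ f ∈ Finset.univ.erase (G.inv x), y f :=
            Finset.sum_le_sum_of_subset_of_nonneg
              (fun f hf => by simpa using (mem_successors.1 hf).2) fun f _ _ => hy f
        _ ≤ (Finset.univ.erase (G.inv x)).card • y x := Finset.sum_le_card_nsmul _ _ _ fun f _ => hx f
        _ = _ := by
          rw [Finset.card_erase_of_mem (Finset.mem_univ _), Finset.card_univ, nsmul_eq_mul,
            Nat.cast_pred Fintype.card_pos]
    have h2 := le_of_mul_le_mul_right ((hsub x).trans h1) hpos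
    rw [hV]
    push_cast
    linarith
  | succ n ih =>
    intro V E _ _ G hG hV R hR y hy hsub hy0
    obtain ⟨e₀, h⟩ := exists_tail_ne_head hG (by omega)
    have hVc : Fintype.card {a : V // a ≠ G.head e₀} = n + 1 := by
      rw [Fintype.card_subtype_compl, Fintype.card_subtype_eq, hV]
      rfl
    -- Two directed edges and one vertex disappear, so the bound is unchanged.
    have hEc := G.card_contract_edges e₀ h
    have := ih (G.contract e₀ h) (hG.contract e₀ h) hVc hR (fun e => y e) (fun e => hy e)
      (G.sum_successors_le_contract hR y hy hsub e₀ h) ?_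
    · rw [hVc] at this
      rw [← hEc, hV]
      push_cast at this ⊢
      linarith
    -- If `y` lived only on `e₀` and its reverse, it would vanish there too: `e₀` is not a loop, so
    -- neither of the two follows either of them.
    · intro h0
      apply hy0
      have hzero : ∀ e, e ≠ e₀ → e ≠ G.inv e₀ → y e = 0 := fun e h1 h2 =>
        congrFun h0 ⟨e, h1, h2⟩
      have hne : ∀ e, (∀ f ∈ G.successors e, f ≠ e₀ ∧ f ≠ G.inv e₀) → y e = 0 := by
        intro e hf
        have h1 := hsub e
        rw [Finset.sum_eq_zero fun f hfe => hzero f (hf f hfe).1 (hf f hfe).2] at h1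
        nlinarith [hy e]
      funext e
      by_cases h1 : e = e₀
      · subst h1
        refine hne _ fun f hf => ⟨?_, (mem_successors.1 hf).2⟩
        rintro rfl
        exact h (mem_successors.1 hf).1
      by_cases h2 : e = G.inv e₀
      · subst h2
        refine hne _ fun f hf => ?_
        rw [mem_successors, G.inv_inv, G.head_inv] at hf
        refine ⟨hf.2, ?_⟩
        rintro rfl
        exact h (by rw [← hf.1, G.tail_inv])
      · exact hzero e h1 h2

/-- Equality fails exactly when there are half-loops, whose orbits are singletons. -/
theorem card_le_two_mul_edgeSet [Fintype E] (G : MGraph V E) :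
    Fintype.card E ≤ 2 * G.edgeSet.ncard := by
  classical
  have hfin : G.edgeSet.Finite := Set.toFinite _
  rw [Set.ncard_eq_toFinset_card _ hfin, ← Finset.card_univ]
  refine Finset.card_le_mul_card_image_of_maps_to (f := fun e => ({e, G.inv e} : Set E))
    (fun e _ => (Set.Finite.mem_toFinset hfin).2 ⟨e, rfl⟩) 2 fun s hs => ?_
  rw [Set.Finite.mem_toFinset] at hs
  obtain ⟨x, rfl⟩ := hs
  refine (Finset.card_le_card (t := {x, G.inv x}) fun e he => ?_).trans Finset.card_le_two
  have h1 : ({e, G.inv e} : Set E) = {x, G.inv x} := (Finset.mem_filter.1 he).2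
  have h2 : e ∈ ({x, G.inv x} : Set E) := h1 ▸ Set.mem_insert _ _
  simpa using h2

theorem le_order_of_subharmonic [Fintype V] [Fintype E] {G : MGraph V E} (hG : G.Connected)
    {R : ℝ} (hR : 1 ≤ R) (y : E → ℝ) (hy : ∀ e, 0 ≤ y e)
    (hsub : ∀ e, R * y e ≤ ∑ f ∈ G.successors e, y f) (hy0 : y ≠ 0) :
    R ≤ 2 * (G.order : ℝ) + 1 := by
  have := hG.1
  have h1 := le_of_subharmonic (Fintype.card V - 1) G hG
    (Nat.sub_add_cancel Fintype.card_pos).symm hR y hy hsub hy0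
  have h2 : (Fintype.card E : ℝ) ≤ 2 * G.edgeSet.ncard := mod_cast G.card_le_two_mul_edgeSet
  simp only [order, Nat.card_eq_fintype_card]
  push_cast
  linarith

end Contraction

/-! ### Eigenvalues of the Hashimoto matrix -/

section Spectrum

variable {V : Type u} {E : Type v} [Fintype E] [DecidableEq E]

open Matrix in
theorem hashimoto_mulVec (G : MGraph V E) (x : E → ℂ) (e : E) :
    (G.hashimoto *ᵥ x) e = ∑ f ∈ G.successors e, x f := by
  classical
  simp only [hashimoto, Matrix.mulVec, dotProduct, Matrix.of_apply, ite_mul, one_mul, zero_mul,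
    successors]
  rw [Finset.sum_filter]
  refine Finset.sum_congr rfl fun f _ => ?_
  congr 1
  rw [eq_comm (a := G.head e), ne_comm]

theorem mem_spectrum_hashimoto_iff (G : MGraph V E) (l : ℂ) :
    l ∈ spectrum ℂ G.hashimoto ↔
      ∃ x : E → ℂ, x ≠ 0 ∧ ∀ e, ∑ f ∈ G.successors e, x f = l * x e := by
  rw [← Matrix.spectrum_toLin', ← Module.End.hasEigenvalue_iff_mem_spectrum]
  constructor
  · intro h
    obtain ⟨x, hx⟩ := h.exists_hasEigenvector
    refine ⟨x, hx.2, fun e => ?_⟩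
    have := congrFun hx.apply_eq_smul e
    rwa [Matrix.toLin'_apply, hashimoto_mulVec] at this
  · rintro ⟨x, hx, hx'⟩
    refine Module.End.hasEigenvalue_of_hasEigenvector (x := x)
      ⟨Module.End.mem_eigenspace_iff.2 (funext fun e => ?_), hx⟩
    rw [Matrix.toLin'_apply, hashimoto_mulVec, hx']
    rfl

/-- Ensures that `toReal` in `mu1` does not collapse an infinite value to `0`. -/
theorem spectralRadius_hashimoto_ne_top (G : MGraph V E) :
    spectralRadius ℂ G.hashimoto ≠ ⊤ := by
  have hfin : (spectrum ℂ G.hashimoto).Finite := Matrix.finite_spectrum _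
  rw [spectralRadius, ← sSup_image]
  rcases (spectrum ℂ G.hashimoto).eq_empty_or_nonempty with h | h
  · simp [h]
  · obtain ⟨l, -, hl⟩ := (h.image fun k : ℂ => (‖k‖₊ : ENNReal)).csSup_mem (hfin.image _)
    rw [← hl]
    exact ENNReal.coe_ne_top

theorem norm_le_mu1 (G : MGraph V E) {l : ℂ} (hl : l ∈ spectrum ℂ G.hashimoto) :
    ‖l‖ ≤ G.mu1 := by
  have : (‖l‖₊ : ENNReal) ≤ spectralRadius ℂ G.hashimoto :=
    le_iSup₂ (f := fun k (_ : k ∈ spectrum ℂ G.hashimoto) => (‖k‖₊ : ENNReal)) l hl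
  simpa [mu1] using ENNReal.toReal_mono G.spectralRadius_hashimoto_ne_top this

theorem mu1_le (G : MGraph V E) {r : ℝ} (hr : 0 ≤ r)
    (h : ∀ l ∈ spectrum ℂ G.hashimoto, ‖l‖ ≤ r) : G.mu1 ≤ r := by
  refine ENNReal.toReal_le_of_le_ofReal hr (iSup₂_le fun l hl => ?_)
  rw [← enorm_eq_nnnorm, ← ofReal_norm]
  exact ENNReal.ofReal_le_ofReal (h l hl)

/-- The Perron-Frobenius eigenvalue of a connected graph is at most that of the bouquet of
whole-loops of the same order, unless it vanishes. -/
theorem mu1_le_of_connected [Fintype V] {G : MGraph V E} (hG : G.Connected) (h0 : 0 < G.mu1) :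
    G.mu1 ≤ 2 * (G.order : ℝ) + 1 := by
  have key : ∀ l ∈ spectrum ℂ G.hashimoto, l ≠ 0 →
      1 ≤ 2 * (G.order : ℝ) + 1 ∧ ‖l‖ ≤ 2 * (G.order : ℝ) + 1 := by
    intro l hl hl0
    obtain ⟨x, hx, hxe⟩ := (G.mem_spectrum_hashimoto_iff l).1 hl
    have hle : ∀ e, ‖l‖ * ‖x e‖ ≤ ∑ f ∈ G.successors e, ‖x f‖ := fun e => by
      rw [← norm_mul, ← hxe]
      exact norm_sum_le _ _
    -- The indicator of the support of `x` is subharmonic with factor `1`, since `l * x e ≠ 0`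
    -- forces a successor in the support. This covers eigenvalues of modulus below `1`.
    have h1 : 1 ≤ 2 * (G.order : ℝ) + 1 := by
      classical
      refine le_order_of_subharmonic hG le_rfl (fun e => if x e = 0 then 0 else 1)
        (fun e => by split_ifs <;> norm_num) (fun e => ?_) ?_
      · by_cases he : x e = 0
        · simp only [he, if_true, mul_zero]
          exact Finset.sum_nonneg fun f _ => by split_ifs <;> norm_num
        · have hf : ∃ f ∈ G.successors e, x f ≠ 0 := by
            by_contra! hn
            have := hxe e
            rw [Finset.sum_eq_zero hn] at this
            exact mul_ne_zero hl0 he this.symm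
          obtain ⟨f, hf, hf0⟩ := hf
          have := Finset.single_le_sum (f := fun f => if x f = 0 then (0 : ℝ) else 1)
            (fun f _ => by split_ifs <;> norm_num) hf
          simpa [he, hf0] using this
      · obtain ⟨e, he⟩ := Function.ne_iff.1 hx
        refine Function.ne_iff.2 ⟨e, ?_⟩
        have he' : x e ≠ 0 := he
        simp [he']
    refine ⟨h1, ?_⟩
    rcases le_total 1 ‖l‖ with h | h
    · refine le_order_of_subharmonic hG h (fun e => ‖x e‖) (fun e => norm_nonneg _) hle ?_
      obtain ⟨e, he⟩ := Function.ne_iff.1 hx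
      exact Function.ne_iff.2 ⟨e, by simpa using he⟩
    · exact h.trans h1
  -- A nonzero eigenvalue is needed: a tree has order `-1`, which makes the bound negative.
  obtain ⟨l, hl, hl0⟩ : ∃ l ∈ spectrum ℂ G.hashimoto, l ≠ 0 := by
    by_contra! hn
    exact h0.not_ge (G.mu1_le le_rfl fun l hl => by simp [hn l hl])
  have h1 := (key l hl hl0).1
  refine G.mu1_le (by linarith) fun k hk => ?_
  by_cases hk0 : k = 0
  · rw [hk0, norm_zero]
    linarith
  · exact (key k hk hk0).2

theorem IsRegular.card_successors {G : MGraph V E} {d : ℕ} (hG : G.IsRegular d) (e : E) :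
    ((G.successors e).card : ℝ) = d - 1 := by
  classical
  have h1 : G.successors e = (Finset.univ.filter fun f => G.tail f = G.head e).erase (G.inv e) := by
    ext f
    simp [mem_successors, and_comm]
  have h2 : (Finset.univ.filter fun f => G.tail f = G.head e).card = d := by
    rw [← hG (G.head e), degree, Set.ncard_eq_toFinset_card']
    congr 1
    ext f
    simp
  have h3 : G.inv e ∈ Finset.univ.filter fun f => G.tail f = G.head e := by
    simp [G.tail_inv]
  rw [h1, Finset.card_erase_of_mem h3, h2, Nat.cast_pred (h2 ▸ Finset.card_pos.2 ⟨_, h3⟩)]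

/-- All row sums are `d - 1`: a largest coordinate of an eigenvector gives the upper bound, the
all-ones eigenvector the lower one. -/
theorem IsRegular.mu1_eq [Nonempty V] {G : MGraph V E} {d : ℕ} (hG : G.IsRegular d)
    (hd : 1 ≤ d) : G.mu1 = (d : ℝ) - 1 := by
  have hd' : (0 : ℝ) ≤ (d : ℝ) - 1 := by
    have : (1 : ℝ) ≤ d := mod_cast hd
    linarith
  obtain ⟨a⟩ := ‹Nonempty V›
  have : Nonempty E := by
    obtain ⟨e, -⟩ := Set.nonempty_of_ncard_ne_zero (s := {e : E | G.tail e = a})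
      (by have := hG a; rw [degree] at this; omega)
    exact ⟨e⟩
  apply le_antisymm
  · refine G.mu1_le hd' fun l hl => ?_
    obtain ⟨x, hx, hxe⟩ := (G.mem_spectrum_hashimoto_iff l).1 hl
    obtain ⟨e, he⟩ := Finite.exists_max fun e => ‖x e‖
    have hpos : 0 < ‖x e‖ := by
      obtain ⟨f, hf⟩ := Function.ne_iff.1 hx
      exact (norm_pos_iff.2 hf).trans_le (he f)
    refine le_of_mul_le_mul_right ?_ hpos
    calc ‖l‖ * ‖x e‖ = ‖∑ f ∈ G.successors e, x f‖ := by rw [hxe, norm_mul]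
      _ ≤ (G.successors e).card • ‖x e‖ :=
        (norm_sum_le _ _).trans (Finset.sum_le_card_nsmul _ _ _ fun f _ => he f)
      _ = _ := by rw [nsmul_eq_mul, hG.card_successors]
  · have hl : ((d : ℂ) - 1) ∈ spectrum ℂ G.hashimoto := by
      refine (G.mem_spectrum_hashimoto_iff _).2 ⟨1, one_ne_zero, fun e => ?_⟩
      have := congrArg (fun r : ℝ => (r : ℂ)) (hG.card_successors e)
      push_cast at this
      simp [this]
    have h1 := G.norm_le_mu1 hl
    have h2 : ‖(d : ℂ) - 1‖ = (d : ℝ) - 1 := by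
      rw [show (d : ℂ) - 1 = (((d : ℝ) - 1 : ℝ) : ℂ) by push_cast; rfl, Complex.norm_real,
        Real.norm_of_nonneg hd']
    rwa [h2] at h1

end Spectrum

/-! ### Bouquets of whole-loops -/

section Bouquet

theorem bouquet_connected (m : ℕ) : (bouquet m).Connected :=
  ⟨⟨()⟩, fun _ _ => .refl⟩

theorem bouquet_isRegular (m : ℕ) : (bouquet m).IsRegular (2 * m) := fun a => by
  have : {e : Fin m × Bool | (bouquet m).tail e = a} = Set.univ := Set.eq_univ_of_forall fun _ => rfl
  rw [degree, this, Set.ncard_univ, Nat.card_eq_fintype_card]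
  simp [mul_comm]

theorem bouquet_order (m : ℕ) : (bouquet m).order = (m : ℤ) - 1 := by
  have : (bouquet m).edgeSet = Set.range fun i : Fin m => ({(i, true), (i, false)} : Set _) := by
    ext s
    constructor
    · rintro ⟨⟨i, b⟩, rfl⟩
      refine ⟨i, ?_⟩
      cases b
      · exact Set.pair_comm _ _
      · rfl
    · rintro ⟨i, rfl⟩
      exact ⟨(i, true), rfl⟩
  have hinj : Function.Injective
      fun i : Fin m => ({(i, true), (i, false)} : Set (Fin m × Bool)) := by
    intro i j hij
    have : (i, true) ∈ ({(j, true), (j, false)} : Set (Fin m × Bool)) := by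
      rw [← show ({(i, true), (i, false)} : Set (Fin m × Bool)) = {(j, true), (j, false)} from hij]
      exact Set.mem_insert _ _
    simpa using this
  rw [order, this, ← Set.image_univ, Set.ncard_image_of_injective _ hinj, Set.ncard_univ]
  simp

theorem bouquet_mu1 {m : ℕ} (hm : 1 ≤ m) : (bouquet m).mu1 = 2 * (m : ℝ) - 1 := by
  rw [(bouquet_isRegular m).mu1_eq (by omega)]
  push_cast
  rfl

/-- A bouquet of `m` whole-loops maps injectively to a graph with `m` whole-loops at a vertex. -/
theorem exists_hom_bouquet {V : Type u} {E : Type v} [Finite E] (B : MGraph V E) (a : V) {m : ℕ}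
    (h : m ≤ (B.wholeLoopsAt a).ncard) :
    ∃ p : Hom (bouquet m) B, Function.Injective p.onE := by
  have hfin : (B.wholeLoopsAt a).Finite := Set.toFinite _
  have := hfin.fintype
  obtain ⟨g⟩ : Nonempty (Fin m ↪ B.wholeLoopsAt a) := by
    apply Function.Embedding.nonempty_of_card_le
    rwa [Fintype.card_fin, ← Nat.card_eq_fintype_card, Nat.card_coe_set_eq]
  choose c hct hch hci hcs using fun i => (g i).2
  have hpair : ∀ i j, c i ∈ ({c j, B.inv (c j)} : Set E) → i = j := by
    intro i j hij
    apply g.injective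
    apply Subtype.ext
    rw [hcs, hcs]
    rcases hij with h | h
    · rw [h]
    · rw [h, B.inv_inv, Set.pair_comm]
  -- The Boolean selects the orientation of the chosen loop; `hci` keeps the two orientations
  -- distinct.
  refine ⟨⟨fun _ => a, fun e => if e.2 then c e.1 else B.inv (c e.1), ?_, ?_, ?_⟩, ?_⟩
  · rintro ⟨i, _ | _⟩
    · simp [B.tail_inv, hch]
    · simp [hct]
  · rintro ⟨i, _ | _⟩
    · simp [B.head_inv, hct]
    · simp [hch]
  · rintro ⟨i, _ | _⟩
    · simp [bouquet, B.inv_inv]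
    · simp [bouquet]
  · rintro ⟨i, _ | _⟩ ⟨j, _ | _⟩ hij
    · obtain rfl := hpair i j (Or.inl (B.inv_injective (by simpa using hij)))
      rfl
    · have h1 : B.inv (c i) = c j := by simpa using hij
      obtain rfl := hpair j i (Or.inr h1.symm)
      exact absurd h1 (hci _)
    · have h1 : c i = B.inv (c j) := by simpa using hij
      obtain rfl := hpair i j (Or.inr h1)
      exact absurd h1.symm (hci _)
    · obtain rfl := hpair i j (Or.inl (by simpa using hij))
      rfl

end Bouquet

/-! ### Occurrence in models and the tangle power -/

section Occurrence

variable {V : Type u} {E : Type v}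

/-- Subgraphs of the base occur in the permutation model. -/
theorem permutationModel_occursOver [Finite E] (B : MGraph V E) (hB : B.NoHalfLoops)
    {W : Type w} {F : Type x} {S : MGraph W F} (p : Hom S B) (hV : Function.Injective p.onV)
    (hE : Function.Injective p.onE) : (permutationModel B hB).OccursOver p := by
  -- The trivial cover consists of `n` disjoint copies of `B`; `S` is placed in sheet `0`.
  refine ⟨0, fun n _ => ⟨⟨fun _ => 1, fun _ => by simp⟩, ?_, ?_⟩⟩
  · let _ : Fintype (Coord B n) := Fintype.ofFinite _
    exact PMF.mem_support_uniformOfFintype (α := Coord B n) _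
  · have hn : 0 < (n : ℕ) := n.2
    refine ⟨⟨fun a => (p.onV a, ⟨0, hn⟩), fun e => (p.onE e, ⟨0, hn⟩), fun e => ?_, fun e => ?_,
      fun e => ?_⟩, fun a b h => hV (congrArg Prod.fst h), fun a b h => hE (congrArg Prod.fst h),
      fun _ => rfl, fun _ => rfl⟩
    · exact Prod.ext (p.tail_comm e) rfl
    · exact Prod.ext (p.head_comm e) rfl
    · exact Prod.ext (p.inv_comm e) rfl

variable [Fintype E] [DecidableEq E] {B : MGraph V E} {m : ℤ}

theorem Model.sub_one_le_of_mem_tangleOrders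
    (hm : IsLeast {k : ℤ | Real.sqrt B.mu1 < 2 * (k : ℝ) - 1} m) (M : Model B) {k : ℤ}
    (hk : k ∈ M.tangleOrders) : m - 1 ≤ k := by
  obtain ⟨W, F, _, _, _, S, hS, -, hmu, rfl⟩ := hk
  have h1 := mu1_le_of_connected hS ((Real.sqrt_nonneg _).trans_lt hmu)
  have h2 : m ≤ S.order + 1 := hm.2 (by
    simp only [Set.mem_ofPred_eq]
    push_cast
    linarith)
  omega

theorem Model.sub_one_le_tanglePower
    (hm : IsLeast {k : ℤ | Real.sqrt B.mu1 < 2 * (k : ℝ) - 1} m) (M : Model B) :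
    (((m : ℝ) - 1 : ℝ) : EReal) ≤ M.tanglePower := by
  refine le_iInf₂ fun k hk => ?_
  have := M.sub_one_le_of_mem_tangleOrders hm hk
  have h : (m : ℝ) - 1 ≤ k := mod_cast this
  exact EReal.coe_le_coe_iff.2 h

theorem Model.tanglePower_eq_of_occurs_bouquet {m : ℕ}
    (hm : IsLeast {k : ℤ | Real.sqrt B.mu1 < 2 * (k : ℝ) - 1} (m : ℤ)) (M : Model B)
    (h : M.Occurs (bouquet m)) : M.tanglePower = (((m : ℝ) - 1 : ℝ) : EReal) := by
  have hlt : Real.sqrt B.mu1 < 2 * (m : ℝ) - 1 := by simpa using hm.1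
  -- For `m = 0` the strict inequality would put a square root below `-1`.
  have hm1 : 1 ≤ m := by
    by_contra hn
    obtain rfl : m = 0 := by omega
    have := Real.sqrt_nonneg B.mu1
    norm_num at hlt
    linarith
  have h1 := (M.tanglePower_eq_iff ((m : ℤ) - 1)).2
    ⟨⟨Unit, Fin m × Bool, inferInstance, inferInstance, inferInstance, bouquet m,
      bouquet_connected m, h, by rwa [bouquet_mu1 hm1], bouquet_order m⟩,
      fun k hk => M.sub_one_le_of_mem_tangleOrders hm hk⟩
  rw [h1]
  push_cast
  rfl

end Occurrence

/-- The condition on `k` is `(s + 1) / 2 < k`; strictness accounts for the `+ 1`. -/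
theorem isLeast_floor (s : ℝ) :
    IsLeast {k : ℤ | s < 2 * (k : ℝ) - 1} (⌊(s + 1) / 2⌋ + 1) := by
  constructor
  · have := Int.lt_floor_add_one ((s + 1) / 2)
    simp only [Set.mem_ofPred_eq]
    push_cast
    linarith
  · intro k hk
    simp only [Set.mem_ofPred_eq] at hk
    rw [Int.add_one_le_iff, Int.floor_lt]
    linarith

end MGraph

theorem theorem7p1 {V : Type u} {E : Type v} [Finite V] [Fintype E] [DecidableEq E]
    (B : MGraph V E) :
    ∃ m : ℕ, IsLeast {k : ℤ | Real.sqrt B.mu1 < 2 * (k : ℝ) - 1} (m : ℤ) ∧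
      (∀ M : MGraph.Model B,
        (((m : ℝ) - 1 : ℝ) : EReal) ≤ M.tanglePower ∧
        (M.Occurs (MGraph.bouquet m) → M.tanglePower = (((m : ℝ) - 1 : ℝ) : EReal))) ∧
      (∀ d : ℕ, 1 ≤ d → Nonempty V → B.IsRegular d →
        B.mu1 = (d : ℝ) - 1 ∧
        (m : ℤ) = ⌊(Real.sqrt ((d : ℝ) - 1) + 1) / 2⌋ + 1 ∧
        (∀ M : MGraph.Model B,
          ((⌊(Real.sqrt ((d : ℝ) - 1) + 1) / 2⌋ : ℝ) : EReal) ≤ M.tanglePower) ∧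
        (∀ hB : B.NoHalfLoops, (∃ a : V, m ≤ (B.wholeLoopsAt a).ncard) →
          (MGraph.permutationModel B hB).tanglePower =
            ((⌊(Real.sqrt ((d : ℝ) - 1) + 1) / 2⌋ : ℝ) : EReal))) := by
  have hm := MGraph.isLeast_floor (Real.sqrt B.mu1)
  obtain ⟨m, hmf⟩ : ∃ m : ℕ, (m : ℤ) = ⌊(Real.sqrt B.mu1 + 1) / 2⌋ + 1 :=
    ⟨_, Int.toNat_of_nonneg (by have := Real.sqrt_nonneg B.mu1; positivity)⟩
  rw [← hmf] at hm
  refine ⟨m, hm, fun M => ⟨by simpa using M.sub_one_le_tanglePower hm,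
    M.tanglePower_eq_of_occurs_bouquet hm⟩, fun d hd _ hreg => ?_⟩
  have hmu := hreg.mu1_eq hd
  rw [hmu] at hmf
  have hcast : (⌊(Real.sqrt ((d : ℝ) - 1) + 1) / 2⌋ : ℝ) = (m : ℝ) - 1 := by
    have := congrArg (fun z : ℤ => (z : ℝ)) hmf
    push_cast at this
    linarith
  rw [hcast]
  refine ⟨hmu, hmf, fun M => by simpa using M.sub_one_le_tanglePower hm, ?_⟩
  rintro hB ⟨a, ha⟩
  obtain ⟨p, hp⟩ := MGraph.exists_hom_bouquet B a ha
  exact MGraph.Model.tanglePower_eq_of_occurs_bouquet hm _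
    ⟨p, MGraph.permutationModel_occursOver B hB p (Function.injective_of_subsingleton _) hp⟩
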